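/- There is an absolute constant $C>0$ such that the following holds for all integers $n,k\ge 1$, every probability distribution $\nu$ on $[k]$, and all $c_1,\dots,c_k\in\mathbb{N}$. Inputs are $X=(X_1,\dots,X_k)\in(\{0,1\}^n)^k$, where player $i$ holds $X_i=(X_i(1),\dots,X_i(n))$. Let $D_0$ be the distribution of $X$ obtained as follows: sample $W_1,\dots,W_n\in[k]$ independently from $\nu$; for each $j\in[n]$, if $W_j=i$, let $X_i(j)$ be an independent uniform bit and set $X_{i'}(j)=0$ for all $i'\ne i$. Let $D_1$ be the distribution obtained by sampling $X\sim D_0$ and an independent uniform $j\in[n]$, and then replacing the bits $X_1(j),\dots,X_k(j)$ by $1$. Let $D$ be the mixture: sample a uniform bit $b$, and then $X\sim D_b$. Let $\Pi$ be a deterministic $k$-party communication protocol in the blackboard model (at each step the bits written so far determine which player writes the next bit, or that the protocol stops with an output bit; the bit written is a function of the writer's input and of the bits written so far). Assume that $\Pi$ is $[c_1,\dots,c_k]$-bounded, i.e. in every transcript player $i$ writes at most $c_i$ bits, and that $\Pi$ solves unique set-disjointness under $D$ with error $2\%$, i.e. $\Pr[\Pi\text{ outputs }b\text{ on }X]\ge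 0.98$ for $(b,X)$ sampled as above. (For $k\ge 2$ the bit $b$ is determined by $X$: $b=0$ if and only if the sets $\{j: X_i(j)=1\}$ are pairwise disjoint, and $b=1$ if and only if they have exactly one common element and are pairwise disjoint apart from it.) Then $$\sum_{i\in[k]}\frac{c_i}{\nu(i)}\ \ge\ C\,n,$$ where a term with $\nu(i)=0$ is read as $+\infty$ if $c_i>0$ and as $0$ if $c_i=0$. -/

import Mathlib

open scoped ENNReal NNReal

noncomputable section

namespace UDisj

/-- The joint input `X = (X_1, …, X_k) ∈ ({0,1}^n)^k`; `X i j` is the bit `X_i(j)`. -/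
abbrev Inputs (k n : ℕ) : Type := Fin k → Fin n → Bool

/-- Deterministic `k`-party protocols in the blackboard model, each player holding an input in `α`.
Either the transcript is complete and carries an output bit, or the transcript so far determines
the next speaker `i`, who appends the bit `msg x` to the blackboard, a function of his own input
`x` (and of the transcript so far, i.e. of the position in the tree). -/
inductive Protocol (k : ℕ) (α : Type) : Type
  | done (out : Bool) : Protocol k α
  | speak (i : Fin k) (msg : α → Bool) (next : Bool → Protocol k α) : Protocol k α

namespace Protocol

variable {k : ℕ} {α : Type}

/-- The transcript `Π(X)`: the list of the bits written, each with its sender. -/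
def transcript : Protocol k α → (Fin k → α) → List (Fin k × Bool)
  | done _, _ => []
  | speak i msg next, X => (i, msg (X i)) :: transcript (next (msg (X i))) X

/-- The output bit of the run on `X` (`true` means "unique intersection"). -/
def output : Protocol k α → (Fin k → α) → Bool
  | done b, _ => b
  | speak i msg next, X => output (next (msg (X i))) X

/-- The number of bits sent by player `i` in the run on `X`. -/
def bitsSent (P : Protocol k α) (i : Fin k) (X : Fin k → α) : ℕ :=
  (P.transcript X).countP fun m => m.1 = i

/-- `[c_1, …, c_k]`-bounded: in any transcript, player `i` sends at most `c i` bits. -/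
def IsBounded (P : Protocol k α) (c : Fin k → ℕ) : Prop :=
  ∀ (X : Fin k → α) (i : Fin k), P.bitsSent i X ≤ c i

end Protocol

variable {k : ℕ}

/-- The product distribution `ν^n` on `[k]^n`. -/
def prodDist (ν : PMF (Fin k)) (n : ℕ) : PMF (Fin n → Fin k) :=
  PMF.ofFintype (fun W => ∏ j, ν (W j)) (by
    rw [← Fintype.prod_sum fun (_ : Fin n) (i : Fin k) => ν i]
    have h : ∑ i, ν i = 1 := by rw [← tsum_fintype (L := .unconditional _)]; exact ν.tsum_coe
    simp [h])

/-- The disjoint asymmetric distribution: `W ∼ ν^n`; in coordinate `j` the player `W j` gets an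
independent uniform bit, and all other players get `0`. -/
def disjDist (ν : PMF (Fin k)) (n : ℕ) : PMF (Inputs k n) :=
  (prodDist ν n).bind fun W =>
    (PMF.uniformOfFintype (Fin n → Bool)).map fun u i j => if W j = i then u j else false

/-- The unique intersection asymmetric distribution: sample `X` from the disjoint distribution and
a uniform coordinate, and give every player a `1` in that coordinate. -/
def interDist (ν : PMF (Fin k)) (n : ℕ) [NeZero n] : PMF (Inputs k n) :=
  (disjDist ν n).bind fun X =>
    (PMF.uniformOfFintype (Fin n)).map fun j₀ i j => if j = j₀ then true else X i j

/-- The distribution indexed by the bit `b`. -/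
def caseDist (ν : PMF (Fin k)) (n : ℕ) [NeZero n] (b : Bool) : PMF (Inputs k n) :=
  if b then interDist ν n else disjDist ν n

/-- The mixture, together with its bit: `b` is a uniform bit and `X` is sampled from the
distribution indexed by `b`; this is the joint distribution of `(b, X)`. -/
def mixDist (ν : PMF (Fin k)) (n : ℕ) [NeZero n] : PMF (Bool × Inputs k n) :=
  (PMF.uniformOfFintype Bool).bind fun b => (caseDist ν n b).map fun X => (b, X)

/-- The promise set of disjoint inputs. -/
def disjInputs (k n : ℕ) : Set (Inputs k n) :=
  {X | ∀ j, (Finset.univ.filter fun i => X i j = true).card ≤ 1}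

/-- The promise set of inputs with a unique intersection. -/
def interInputs (k n : ℕ) : Set (Inputs k n) :=
  {X | ∃ j, (Finset.univ.filter fun i => X i j = true).card = k ∧
    ∀ j' ≠ j, (Finset.univ.filter fun i => X i j' = true).card ≤ 1}

/-- The protocol solves unique set-disjointness under the mixture with error `δ`: its output is the
correct answer, namely the case from which the input was sampled, except with probability `δ`.
For at least two players the two cases are supported on the two disjoint promise sets, so the
answer is a function of the input alone: see `solvesWithError_iff`. -/
def SolvesWithError {n : ℕ} [NeZero n] (P : Protocol k (Fin n → Bool)) (ν : PMF (Fin k))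
    (δ : ℝ≥0∞) : Prop :=
  (mixDist ν n).toOuterMeasure {p | P.output p.2 ≠ p.1} ≤ δ

theorem disjDist_support (ν : PMF (Fin k)) (n : ℕ) {X : Inputs k n}
    (hX : X ∈ (disjDist ν n).support) : X ∈ disjInputs k n := by
  simp only [disjDist, PMF.mem_support_bind_iff, PMF.mem_support_map_iff] at hX
  obtain ⟨W, -, u, -, rfl⟩ := hX
  intro j
  refine Finset.card_le_one.2 fun a ha b hb => ?_
  simp only [Finset.mem_filter, Finset.mem_univ, true_and] at ha hb
  grind

theorem interDist_support (ν : PMF (Fin k)) (n : ℕ) [NeZero n] {X : Inputs k n}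
    (hX : X ∈ (interDist ν n).support) : X ∈ interInputs k n := by
  simp only [interDist, PMF.mem_support_bind_iff, PMF.mem_support_map_iff] at hX
  obtain ⟨Y, hY, j, -, rfl⟩ := hX
  refine ⟨j, by simp, fun j' hj' => ?_⟩
  simpa [hj'] using disjDist_support ν n hY j'

theorem disjoint_inputs (hk : 2 ≤ k) (n : ℕ) : Disjoint (disjInputs k n) (interInputs k n) := by
  refine Set.disjoint_left.2 fun X h0 ⟨j, hj, _⟩ => ?_
  have := h0 j
  omega

/-- For `k ≥ 2` players, solving with error `δ` means: when the input is sampled from the mixture,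
the output correctly tells in which of the two promise sets the input lies, except with
probability `δ`. -/
theorem solvesWithError_iff (hk : 2 ≤ k) {n : ℕ} [NeZero n] (P : Protocol k (Fin n → Bool))
    (ν : PMF (Fin k)) (δ : ℝ≥0∞) :
    SolvesWithError P ν δ ↔
      ((mixDist ν n).map Prod.snd).toOuterMeasure
        {X | ¬ ((P.output X = false ∧ X ∈ disjInputs k n) ∨
          (P.output X = true ∧ X ∈ interInputs k n))} ≤ δ := by
  rw [SolvesWithError, PMF.toOuterMeasure_map_apply]
  suffices h : (mixDist ν n).toOuterMeasure {p | P.output p.2 ≠ p.1} =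
      (mixDist ν n).toOuterMeasure (Prod.snd ⁻¹' {X | ¬ ((P.output X = false ∧ X ∈ disjInputs k n) ∨
          (P.output X = true ∧ X ∈ interInputs k n))}) by rw [h]
  apply PMF.toOuterMeasure_apply_eq_of_inter_support_eq
  ext ⟨b, X⟩
  simp only [Set.mem_inter_iff, Set.mem_ofPred_eq, Set.mem_preimage, and_congr_left_iff]
  intro hp
  simp only [mixDist, PMF.mem_support_bind_iff, PMF.mem_support_map_iff] at hp
  obtain ⟨b', -, X', hX', h⟩ := hp
  obtain ⟨rfl, rfl⟩ := Prod.mk.inj h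
  have hd : X' ∈ disjInputs k n → X' ∉ interInputs k n :=
    fun h0 h1 => Set.disjoint_left.1 (disjoint_inputs hk n) h0 h1
  cases b'
  · have h0 := disjDist_support ν n (X := X') (by simpa [caseDist] using hX')
    have h1 := hd h0
    simp [h0, h1]
  · have h1 := interDist_support ν n (X := X') (by simpa [caseDist] using hX')
    have h0 : X' ∉ disjInputs k n := fun h => hd h h1
    simp [h0, h1]

end UDisj

end

/-!
The argument is a direct-sum reduction to one coordinate, with Hellinger distances in place of mutual
information.

Fix the owners `W` and a coordinate `j`. Given `W`, the players' inputs are independent, so by the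
rectangle property the probability of a transcript `τ`, given which players have a `1` in
coordinate `j`, is a product over the players. Its square root is `amplitude P W j A τ`, where `A`
is the set of players with a `1`, and `sqDist` is the squared `ℓ²` distance of two such vectors.

* The protocol tells `A = ∅` from `A = univ` for an average pair `(j, W)`: under the disjoint
  distribution the column `j` vanishes with probability at least one half, and under the intersecting
  one a uniformly random column is set to one. Hence the mean of `sqDist … ∅ univ` is at least
  `42/100` (`le_sum_sqDist_amplitude`).
* By the product structure, `f A * f B = f ∅ * f (A ∪ B)` for disjoint `A`, `B`, which gives
  `sqDist … ∅ univ ≤ 4 * ∑ i, sqDist … ∅ {i}` whatever the number of players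
  (`sqDist_empty_univ_le`). The union of two boxes in a random partition of the players into `N`
  boxes shows that the mean distance for a random set of players of density `2 / N` is at most
  `2 N / (N - 1)` times that for density `1 / N`; iterating over `N = 2, 4, 8, …` ends at singletons.
* A set of mass `m` in a cube satisfies a level-one inequality
  (`sum_sqrt_sub_sqrt_sq_le_negMulLog`), and the entropy of what player `i` reveals is at most
  `c i * log 2` (`Protocol.sum_prod_erase_mul_negMulLog_le`). Together, the distances
  `sqDist … ∅ {i}` over the coordinates owned by `i` add up to at most `3 * c i`
  (`sum_sqDist_amplitude_le`). As `sqDist … ∅ {i}` for the coordinate `j` does not depend on `W j`,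
  dropping the condition `W j = i` costs a factor `1 / ν i`
  (`mul_sum_sqDist_amplitude_le`).
-/

noncomputable section

namespace UDisj

/-! ### The distance between the extreme inputs of a rectangular family -/

section Hellinger

variable {ι T : Type*}

/-- The squared distance between the vectors `f A` and `f B`; for `f A = √(p A)` with
distributions `p A` it is twice the squared Hellinger distance. -/
def sqDist (s : Finset T) (f : Finset ι → T → ℝ) (A B : Finset ι) : ℝ :=
  ∑ τ ∈ s, (f A τ - f B τ) ^ 2

variable {s : Finset T} {f : Finset ι → T → ℝ}

theorem sqDist_nonneg (A B : Finset ι) : 0 ≤ sqDist s f A B :=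
  Finset.sum_nonneg fun _ _ => sq_nonneg _

/-- Among `N` vectors, the pairwise squared distances are bounded on average by twice the squared
distances to a fixed vector. -/
theorem sum_sum_sqDist_le {N : ℕ} (A : Fin N → Finset ι) :
    ∑ a, ∑ b, sqDist s f (A a) (A b) ≤ 2 * N * ∑ a, sqDist s f ∅ (A a) := by
  have pt : ∀ x : Fin N → ℝ, ∑ a, ∑ b, (x a - x b) ^ 2 ≤ 2 * N * ∑ a, x a ^ 2 := by
    intro x
    have h : ∑ a, ∑ b, (x a - x b) ^ 2 = 2 * N * ∑ a, x a ^ 2 - 2 * (∑ a, x a) ^ 2 := by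
      simp only [sub_sq, Finset.sum_add_distrib, Finset.sum_sub_distrib, Finset.sum_const,
        Finset.card_univ, Fintype.card_fin, nsmul_eq_mul, ← Finset.mul_sum, ← Finset.sum_mul,
        sq (∑ a, x a)]
      ring
    nlinarith [sq_nonneg (∑ a, x a)]
  have h1 : ∑ a, ∑ b, sqDist s f (A a) (A b) =
      ∑ τ ∈ s, ∑ a, ∑ b, ((f ∅ τ - f (A a) τ) - (f ∅ τ - f (A b) τ)) ^ 2 := by
    rw [Finset.sum_comm (s := s)]
    refine Finset.sum_congr rfl fun a _ => ?_
    rw [Finset.sum_comm (s := s)]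
    exact Finset.sum_congr rfl fun b _ => Finset.sum_congr rfl fun τ _ => by ring
  have h2 : ∑ a, sqDist s f ∅ (A a) = ∑ τ ∈ s, ∑ a, (f ∅ τ - f (A a) τ) ^ 2 := by
    simp only [sqDist]; rw [Finset.sum_comm]
  rw [h1, h2, Finset.mul_sum]
  exact Finset.sum_le_sum fun τ _ => pt _

/-- The cut-and-paste property of the Hellinger distance: the players of a private-coin protocol
may swap their inputs. -/
theorem sqDist_eq_sqDist_empty_union [DecidableEq ι] (hf : ∀ A, ∑ τ ∈ s, f A τ ^ 2 = 1)
    (hmul : ∀ A B, Disjoint A B → ∀ τ ∈ s, f A τ * f B τ = f ∅ τ * f (A ∪ B) τ)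
    {A B : Finset ι} (h : Disjoint A B) :
    sqDist s f A B = sqDist s f ∅ (A ∪ B) := by
  have key : ∀ A B : Finset ι, sqDist s f A B = 2 - 2 * ∑ τ ∈ s, f A τ * f B τ := by
    intro A B
    have : ∀ τ ∈ s, (f A τ - f B τ) ^ 2 = f A τ ^ 2 + f B τ ^ 2 - 2 * (f A τ * f B τ) :=
      fun τ _ => by ring
    rw [sqDist, Finset.sum_congr rfl this, Finset.sum_sub_distrib, Finset.sum_add_distrib,
      hf, hf, Finset.mul_sum]
    norm_num
  rw [key, key, Finset.sum_congr rfl (hmul A B h)]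

variable [Fintype ι]

/-- The mean of `F S` over the random subset `S` of `ι` that contains each element independently
with probability `p`. -/
def randomSubsetMean (F : Finset ι → ℝ) (p : ℝ) : ℝ :=
  ∑ S, p ^ S.card * (1 - p) ^ (Fintype.card ι - S.card) * F S

theorem randomSubsetMean_one (F : Finset ι → ℝ) :
    randomSubsetMean F 1 = F Finset.univ := by
  unfold randomSubsetMean
  rw [Finset.sum_eq_single Finset.univ]
  · simp
  · intro S _ hS
    have : S.card < Fintype.card ι := Finset.card_lt_card (Finset.ssubset_univ_iff.2 hS)
    simp [zero_pow (show Fintype.card ι - S.card ≠ 0 by omega)]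
  · simp

/-- At small density the mean is dominated by the singletons. -/
theorem randomSubsetMean_le_of_small {F : Finset ι → ℝ} (hF : ∀ S, 0 ≤ F S) (h0 : F ∅ = 0)
    {p : ℝ} (hp0 : 0 ≤ p) (hp1 : p ≤ 1) :
    randomSubsetMean F p ≤ p * ∑ i, F {i} + p ^ 2 * ∑ S, F S := by
  have hterm : ∀ S : Finset ι, p ^ S.card * (1 - p) ^ (Fintype.card ι - S.card) * F S ≤
      (if S.card = 1 then p * F S else 0) + p ^ 2 * F S := by
    intro S
    have hq : (1 - p) ^ (Fintype.card ι - S.card) ≤ 1 :=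
      pow_le_one₀ (by linarith) (by linarith)
    have hle : p ^ S.card * (1 - p) ^ (Fintype.card ι - S.card) * F S ≤ p ^ S.card * F S := by
      refine mul_le_mul_of_nonneg_right ?_ (hF S)
      exact mul_le_of_le_one_right (by positivity) hq
    refine hle.trans ?_
    have hnn : 0 ≤ p ^ 2 * F S := mul_nonneg (by positivity) (hF S)
    split_ifs with hc
    · rw [hc, pow_one]; linarith
    · rcases Nat.eq_zero_or_pos S.card with h | h
      · rw [Finset.card_eq_zero.1 h, h0]; simp
      · have : p ^ S.card ≤ p ^ 2 := pow_le_pow_of_le_one hp0 hp1 (by omega)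
        have := mul_le_mul_of_nonneg_right this (hF S)
        linarith
  refine (Finset.sum_le_sum fun S _ => hterm S).trans ?_
  rw [Finset.sum_add_distrib, ← Finset.mul_sum, ← Finset.sum_filter, ← Finset.mul_sum]
  have : ∑ S : Finset ι with S.card = 1, F S = ∑ i, F {i} := by
    symm
    refine Finset.sum_bij (fun i _ => {i}) (by simp) (by simp) ?_ (by simp)
    intro S hS
    obtain ⟨i, hi⟩ := Finset.card_eq_one.1 (Finset.mem_filter.1 hS).2
    exact ⟨i, by simp, hi.symm⟩
  rw [this]

variable [DecidableEq ι]

/-- Sorting the elements of `ι` into `N` boxes at random, the content of the boxes in `B` is a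
random subset of density `|B| / N`. -/
theorem sum_filter_mem_eq_randomSubsetMean (F : Finset ι → ℝ) {N : ℕ} (hN : N ≠ 0)
    (B : Finset (Fin N)) :
    ∑ g : ι → Fin N, F (Finset.univ.filter fun i => g i ∈ B) =
      (N : ℝ) ^ Fintype.card ι * randomSubsetMean F (B.card / N) := by
  have hfib : ∀ S : Finset ι,
      ((Finset.univ : Finset (ι → Fin N)).filter
        fun g => (Finset.univ.filter fun i => g i ∈ B) = S).card =
      B.card ^ S.card * (N - B.card) ^ (Fintype.card ι - S.card) := by
    intro S
    have : ((Finset.univ : Finset (ι → Fin N)).filter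
        fun g => (Finset.univ.filter fun i => g i ∈ B) = S) =
        Fintype.piFinset fun i => if i ∈ S then B else Bᶜ := by
      ext g
      simp only [Finset.mem_filter, Finset.mem_univ, true_and, Fintype.mem_piFinset,
        Finset.ext_iff]
      refine forall_congr' fun i => ?_
      by_cases hi : i ∈ S <;> simp [hi]
    rw [this, Fintype.card_piFinset]
    simp only [apply_ite Finset.card, Finset.prod_ite, Finset.prod_const, Finset.card_compl,
      Fintype.card_fin]
    rw [Finset.filter_not]
    simp [Finset.card_sdiff]
  rw [← Finset.sum_fiberwise_of_maps_to (s := Finset.univ) (t := Finset.univ)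
    (g := fun g : ι → Fin N => Finset.univ.filter fun i => g i ∈ B) (fun _ _ => Finset.mem_univ _),
    randomSubsetMean, Finset.mul_sum]
  refine Finset.sum_congr rfl fun S _ => ?_
  rw [Finset.sum_congr rfl (g := fun _ => F S) (by intro g hg; rw [(Finset.mem_filter.1 hg).2]),
    Finset.sum_const, hfib, nsmul_eq_mul]
  have hB : B.card ≤ N := by simpa using Finset.card_le_univ B
  have hS : S.card ≤ Fintype.card ι := Finset.card_le_univ S
  have hN' : (N : ℝ) ≠ 0 := by exact_mod_cast hN
  have h1 : (1 - (B.card : ℝ) / N) = (N - B.card) / N := by field_simp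
  push_cast [Nat.cast_sub hB]
  rw [h1, div_pow, div_pow, ← mul_assoc]
  congr 1
  have h2 : (N : ℝ) ^ Fintype.card ι = N ^ S.card * N ^ (Fintype.card ι - S.card) := by
    rw [← pow_add, Nat.add_sub_cancel' hS]
  rw [h2]
  field_simp

/-- Doubling the density of the random subset little more than doubles the mean squared distance:
the union of two boxes of a random partition into `N` boxes is compared, by cut-and-paste, with the
two boxes. -/
theorem randomSubsetMean_two_div_le (hf : ∀ A, ∑ τ ∈ s, f A τ ^ 2 = 1)
    (hmul : ∀ A B, Disjoint A B → ∀ τ ∈ s, f A τ * f B τ = f ∅ τ * f (A ∪ B) τ)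
    {N : ℕ} (hN : N ≠ 0) :
    (N - 1 : ℝ) * randomSubsetMean (sqDist s f ∅) (2 / N) ≤
      2 * N * randomSubsetMean (sqDist s f ∅) (1 / N) := by
  set φ := randomSubsetMean (sqDist s f ∅)
  let box (g : ι → Fin N) (a : Fin N) : Finset ι := Finset.univ.filter fun i => g i ∈ ({a} : Finset _)
  have hone : ∀ a : Fin N, ∑ g : ι → Fin N, sqDist s f ∅ (box g a) =
      (N : ℝ) ^ Fintype.card ι * φ (1 / N) := fun a => by
    simpa [box, φ] using sum_filter_mem_eq_randomSubsetMean (sqDist s f ∅) hN {a}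
  have htwo : ∀ a b : Fin N, a ≠ b → ∑ g : ι → Fin N, sqDist s f (box g a) (box g b) =
      (N : ℝ) ^ Fintype.card ι * φ (2 / N) := fun a b hab => by
    have := sum_filter_mem_eq_randomSubsetMean (sqDist s f ∅) hN {a, b}
    rw [Finset.card_pair hab] at this
    push_cast at this
    rw [← this]
    refine Finset.sum_congr rfl fun g _ => ?_
    rw [sqDist_eq_sqDist_empty_union hf hmul]
    · congr 1
      ext i
      simp [box]
    · rw [Finset.disjoint_filter]
      simp only [Finset.mem_singleton]
      rintro i - rfl
      exact hab
  have hdiag : ∀ a : Fin N, ∑ g : ι → Fin N, sqDist s f (box g a) (box g a) = 0 := by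
    simp [sqDist]
  have hsum : ∑ g : ι → Fin N, ∑ a, ∑ b, sqDist s f (box g a) (box g b) ≤
      ∑ g : ι → Fin N, 2 * N * ∑ a, sqDist s f ∅ (box g a) :=
    Finset.sum_le_sum fun g _ => sum_sum_sqDist_le (box g)
  have hR : ∑ g : ι → Fin N, 2 * N * ∑ a, sqDist s f ∅ (box g a) =
      (N : ℝ) ^ Fintype.card ι * N * (2 * N * φ (1 / N)) := by
    rw [← Finset.mul_sum, Finset.sum_comm, Finset.sum_congr rfl fun a _ => hone a]
    simp
    ring
  have hL : ∑ g : ι → Fin N, ∑ a, ∑ b, sqDist s f (box g a) (box g b) =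
      (N : ℝ) ^ Fintype.card ι * N * ((N - 1) * φ (2 / N)) := by
    rw [Finset.sum_comm]
    have : ∀ a : Fin N, ∑ g : ι → Fin N, ∑ b, sqDist s f (box g a) (box g b) =
        (N - 1) * ((N : ℝ) ^ Fintype.card ι * φ (2 / N)) := by
      intro a
      rw [Finset.sum_comm, ← Finset.add_sum_erase _ _ (Finset.mem_univ a), hdiag a,
        Finset.sum_congr rfl fun b hb => htwo a b (Finset.ne_of_mem_erase hb).symm]
      rw [Finset.sum_const, Finset.card_erase_of_mem (Finset.mem_univ a), Finset.card_univ,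
        Fintype.card_fin, nsmul_eq_mul, Nat.cast_sub (by omega)]
      simp
    rw [Finset.sum_congr rfl fun a _ => this a]
    simp
    ring
  rw [hL, hR] at hsum
  have hpos : (0 : ℝ) < (N : ℝ) ^ Fintype.card ι * N := by positivity
  exact le_of_mul_le_mul_left hsum hpos

/-- If `f A f B = f ∅ f (A ∪ B)` for disjoint sets `A`, `B` of players and all `f A` are unit
vectors, then the squared distance of `f univ` from `f ∅` is at most four times the sum of the
squared distances of the `f {i}`, however many players there are. -/
theorem sqDist_empty_univ_le (hf : ∀ A, ∑ τ ∈ s, f A τ ^ 2 = 1)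
    (hmul : ∀ A B, Disjoint A B → ∀ τ ∈ s, f A τ * f B τ = f ∅ τ * f (A ∪ B) τ) :
    sqDist s f ∅ Finset.univ ≤ 4 * ∑ i, sqDist s f ∅ {i} := by
  set φ := randomSubsetMean (sqDist s f ∅)
  have hnn : 0 ≤ φ 1 := by
    simp only [φ, randomSubsetMean_one]; exact sqDist_nonneg _ _
  -- The loss factors `1 - 2⁻ᵗ` have a product above `1/4`; the extra term makes this inductive.
  have hind : ∀ t : ℕ, φ 1 * (1 / 4 + (1 / 2) ^ (t + 2)) ≤ 2 ^ (t + 1) * φ ((1 / 2) ^ (t + 1)) := by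
    intro t
    induction t with
    | zero =>
      have := randomSubsetMean_two_div_le hf hmul (N := 2) (by norm_num)
      norm_num at this ⊢
      change φ 1 ≤ 4 * φ (1 / 2) at this
      linarith
    | succ t ih =>
      have h := randomSubsetMean_two_div_le hf hmul (N := 2 ^ (t + 2)) (by positivity)
      push_cast at h
      have e1 : (2 : ℝ) / 2 ^ (t + 2) = (1 / 2) ^ (t + 1) := by
        rw [div_pow, one_pow]; field_simp; ring
      have e2 : (1 : ℝ) / 2 ^ (t + 2) = (1 / 2) ^ (t + 2) := by
        rw [div_pow, one_pow]
      rw [e1, e2] at h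
      change ((2 : ℝ) ^ (t + 2) - 1) * φ ((1 / 2) ^ (t + 1)) ≤
        2 * 2 ^ (t + 2) * φ ((1 / 2) ^ (t + 2)) at h
      set x : ℝ := (1 / 2) ^ (t + 2) with hx
      have hxy : x * 2 ^ (t + 2) = 1 := by
        rw [hx, ← mul_pow]; norm_num
      have hx0 : 0 < x := by positivity
      have hx4 : x ≤ 1 / 4 := by
        have : x ≤ (1 / 2) ^ 2 := pow_le_pow_of_le_one (by norm_num) (by norm_num) (by omega)
        linarith
      have hx' : ((1 : ℝ) / 2) ^ (t + 1 + 2) = x / 2 := by rw [hx]; ring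
      rw [hx']
      have hy : (2 : ℝ) ^ (t + 2) = 2 * 2 ^ (t + 1) := by ring
      have hstep : (1 - x) * (2 ^ (t + 1) * φ ((1 / 2) ^ (t + 1))) ≤
          2 ^ (t + 1 + 1) * φ x := by
        have h3 := mul_le_mul_of_nonneg_left h hx0.le
        have h4 : x * ((2 ^ (t + 2) - 1) * φ ((1 / 2) ^ (t + 1))) =
            (x * 2 ^ (t + 2)) * ((1 - x) * φ ((1 / 2) ^ (t + 1))) := by
          linear_combination (x * φ ((1 / 2) ^ (t + 1))) * hxy
        have h5 : x * (2 * 2 ^ (t + 2) * φ x) = (x * 2 ^ (t + 2)) * (2 * φ x) := by ring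
        rw [h4, h5, hxy, one_mul, one_mul] at h3
        have := mul_le_mul_of_nonneg_left h3 (show (0 : ℝ) ≤ 2 ^ (t + 1) by positivity)
        calc _ = 2 ^ (t + 1) * ((1 - x) * φ ((1 / 2) ^ (t + 1))) := by ring
          _ ≤ _ := this
          _ = _ := by ring
      have h6 : φ 1 * (1 / 4 + x / 2) ≤ (1 - x) * (φ 1 * (1 / 4 + x)) := by
        have : 0 ≤ φ 1 * (x * (1 / 4 - x)) :=
          mul_nonneg hnn (mul_nonneg hx0.le (by linarith))
        nlinarith
      exact h6.trans ((mul_le_mul_of_nonneg_left ih (by linarith)).trans hstep)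
  have hbound : ∀ t : ℕ, φ 1 / 4 ≤ ∑ i, sqDist s f ∅ {i} +
      (1 / 2) ^ (t + 1) * ∑ S, sqDist s f ∅ S := by
    intro t
    have h1 := hind t
    have h2 := randomSubsetMean_le_of_small (F := sqDist s f ∅) (fun S => sqDist_nonneg _ _)
      (by simp [sqDist]) (p := (1 / 2) ^ (t + 1)) (by positivity)
      (pow_le_one₀ (by norm_num) (by norm_num))
    have h3 := mul_le_mul_of_nonneg_left h2 (show (0 : ℝ) ≤ 2 ^ (t + 1) by positivity)
    have hxy : (2 : ℝ) ^ (t + 1) * (1 / 2) ^ (t + 1) = 1 := by rw [← mul_pow]; norm_num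
    have h4 : (2 : ℝ) ^ (t + 1) * ((1 / 2) ^ (t + 1) * ∑ i, sqDist s f ∅ {i} +
        ((1 / 2) ^ (t + 1)) ^ 2 * ∑ S, sqDist s f ∅ S) =
        ∑ i, sqDist s f ∅ {i} + (1 / 2) ^ (t + 1) * ∑ S, sqDist s f ∅ S := by
      linear_combination (∑ i, sqDist s f ∅ {i} + (1 / 2) ^ (t + 1) * ∑ S, sqDist s f ∅ S) * hxy
    rw [h4] at h3
    have h5 : 0 ≤ φ 1 * (1 / 2) ^ (t + 2) := by positivity
    change 2 ^ (t + 1) * φ ((1 / 2) ^ (t + 1)) ≤ _ at h3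
    linarith
  have hlim : Filter.Tendsto (fun t : ℕ => ∑ i, sqDist s f ∅ {i} +
      (1 / 2 : ℝ) ^ (t + 1) * ∑ S, sqDist s f ∅ S) Filter.atTop
      (nhds (∑ i, sqDist s f ∅ {i} + 0 * ∑ S, sqDist s f ∅ S)) :=
    (((tendsto_pow_atTop_nhds_zero_of_lt_one (by norm_num) (by norm_num)).comp
      (Filter.tendsto_add_atTop_nat 1)).mul_const _).const_add _
  have h := ge_of_tendsto' hlim hbound
  rw [← randomSubsetMean_one (sqDist s f ∅)]
  change φ 1 ≤ _
  linarith

end Hellinger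

/-! ### Transcripts, rectangles and entropy -/

namespace Protocol

variable {k : ℕ} {α : Type}

/-- The transcript determines the output. -/
theorem output_eq_of_transcript_eq (P : Protocol k α) {X Y : Fin k → α}
    (h : P.transcript X = P.transcript Y) : P.output X = P.output Y := by
  induction P with
  | done b => rfl
  | speak i msg next ih =>
    simp only [transcript, List.cons.injEq, Prod.mk.injEq, true_and] at h
    simp only [output]
    obtain ⟨hb, h⟩ := h
    rw [← hb] at h ⊢
    exact ih _ h

/-- The rectangle property: if each `X i` is compatible with the transcript `τ`, then `X` has
transcript `τ`. -/
theorem transcript_eq_of_forall (P : Protocol k α) {X Z : Fin k → α} {τ : List (Fin k × Bool)}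
    (hZ : P.transcript Z = τ) (h : ∀ i, ∃ Y, Y i = X i ∧ P.transcript Y = τ) :
    P.transcript X = τ := by
  induction P generalizing τ with
  | done b => exact hZ
  | speak i msg next ih =>
    obtain ⟨Y, hY, rfl⟩ := h i
    simp only [transcript, hY, List.cons.injEq, Prod.mk.injEq, true_and] at h hZ ⊢
    rw [hZ.1] at hZ
    refine ih _ hZ.2 fun i' => ?_
    obtain ⟨Y', h1, h2, h3⟩ := h i'
    exact ⟨Y', h1, by rw [← h3, h2]⟩

/-- When the inputs of all players but `i` are fixed, and player `i` writes at most `c` bits, there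
are at most `2 ^ c` transcripts. The set `S` restricts the inputs of player `i`; it shrinks along
the protocol. -/
theorem card_image_transcript_le (P : Protocol k α) (X : Fin k → α) (i : Fin k) (S : Finset α)
    (c : ℕ) (hc : ∀ x ∈ S, P.bitsSent i (Function.update X i x) ≤ c) :
    (S.image fun x => P.transcript (Function.update X i x)).card ≤ 2 ^ c := by
  induction P generalizing S c with
  | done b =>
    refine (Finset.card_le_card (t := {[]}) ?_).trans ?_
    · simp [transcript, Finset.subset_iff]
    · simpa using Nat.one_le_two_pow
  | speak a msg next ih =>
    by_cases ha : a = i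
    · subst ha
      rcases S.eq_empty_or_nonempty with rfl | ⟨x₀, hx₀⟩
      · simp
      have hc' : ∀ x ∈ S, (next (msg x)).bitsSent a (Function.update X a x) + 1 ≤ c := by
        intro x hx
        simpa [bitsSent, transcript] using hc x hx
      obtain ⟨c, rfl⟩ : ∃ c', c = c' + 1 := ⟨c - 1, by have := hc' x₀ hx₀; omega⟩
      have hb : ∀ b : Bool, ((S.filter fun x => msg x = b).image
          fun x => (next b).transcript (Function.update X a x)).card ≤ 2 ^ c := by
        intro b
        refine ih b _ _ fun x hx => ?_
        obtain ⟨hxS, rfl⟩ := Finset.mem_filter.1 hx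
        have := hc' x hxS
        omega
      have hsub : (S.image fun x => (speak a msg next).transcript (Function.update X a x)) ⊆
          (((S.filter fun x => msg x = true).image
            fun x => (next true).transcript (Function.update X a x)).image (List.cons (a, true))) ∪
          (((S.filter fun x => msg x = false).image
            fun x => (next false).transcript (Function.update X a x)).image
              (List.cons (a, false))) := by
        intro τ hτ
        obtain ⟨x, hx, rfl⟩ := Finset.mem_image.1 hτ
        simp only [transcript, Function.update_self, Finset.mem_union, Finset.mem_image,
          Finset.mem_filter]
        cases hm : msg x
        · exact Or.inr ⟨_, ⟨x, ⟨hx, hm⟩, rfl⟩, rfl⟩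
        · exact Or.inl ⟨_, ⟨x, ⟨hx, hm⟩, rfl⟩, rfl⟩
      calc _ ≤ _ := Finset.card_le_card hsub
        _ ≤ _ := Finset.card_union_le _ _
        _ ≤ 2 ^ c + 2 ^ c :=
          Nat.add_le_add (Finset.card_image_le.trans (hb true))
            (Finset.card_image_le.trans (hb false))
        _ = 2 ^ (c + 1) := by ring
    · have hcons : (S.image fun x => (speak a msg next).transcript (Function.update X i x)) =
          (S.image fun x => (next (msg (X a))).transcript (Function.update X i x)).image
            (List.cons (a, msg (X a))) := by
        rw [Finset.image_image]
        refine Finset.image_congr fun x _ => ?_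
        simp [transcript, Function.update_of_ne ha]
      rw [hcons]
      refine Finset.card_image_le.trans (ih _ _ _ fun x hx => ?_)
      simpa [bitsSent, transcript, Function.update_of_ne ha, ha] using hc x hx

variable [Fintype α] [DecidableEq α]

/-- The transcripts that occur. -/
def transcripts (P : Protocol k α) : Finset (List (Fin k × Bool)) :=
  Finset.univ.image P.transcript

/-- The inputs of player `i` that are compatible with the transcript `τ`: the `i`-th side of the
rectangle of inputs with transcript `τ`. -/
def side (P : Protocol k α) (i : Fin k) (τ : List (Fin k × Bool)) : Finset α :=
  (Finset.univ.filter fun X => P.transcript X = τ).image fun X => X i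

theorem mem_side {P : Protocol k α} {i : Fin k} {τ : List (Fin k × Bool)} {x : α} :
    x ∈ P.side i τ ↔ ∃ Y, Y i = x ∧ P.transcript Y = τ := by
  simp [side, and_comm]

theorem filter_transcript_eq (P : Protocol k α) {τ : List (Fin k × Bool)}
    (hτ : τ ∈ P.transcripts) :
    (Finset.univ.filter fun X => P.transcript X = τ) = Fintype.piFinset fun i => P.side i τ := by
  obtain ⟨Z, -, hZ⟩ := Finset.mem_image.1 hτ
  ext X
  simp only [Finset.mem_filter, Finset.mem_univ, true_and, Fintype.mem_piFinset, mem_side]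
  exact ⟨fun h i => ⟨X, rfl, h⟩, P.transcript_eq_of_forall hZ⟩

/-- Under a product measure, the probability of a transcript factors over the players. -/
theorem sum_filter_transcript (P : Protocol k α) (w : Fin k → α → ℝ) {τ : List (Fin k × Bool)}
    (hτ : τ ∈ P.transcripts) :
    ∑ X with P.transcript X = τ, ∏ i, w i (X i) = ∏ i, ∑ x ∈ P.side i τ, w i x := by
  rw [P.filter_transcript_eq hτ, Finset.prod_univ_sum]

theorem sum_transcripts (P : Protocol k α) (w : Fin k → α → ℝ) :
    ∑ τ ∈ P.transcripts, ∏ i, ∑ x ∈ P.side i τ, w i x = ∏ i, ∑ x, w i x := by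
  rw [← Finset.sum_congr rfl fun τ hτ => P.sum_filter_transcript w hτ,
    Finset.sum_fiberwise_of_maps_to (t := P.transcripts)
      fun X _ => Finset.mem_image_of_mem _ (Finset.mem_univ X),
    Finset.prod_univ_sum, Fintype.piFinset_univ]

/-- The mean number of transcripts that remain possible when all players but `i` have drawn their
inputs. -/
theorem sum_transcripts_prod_erase_le (P : Protocol k α) {w : Fin k → α → ℝ}
    (hw : ∀ i x, 0 ≤ w i x) (hw1 : ∀ i, ∑ x, w i x = 1) {c : Fin k → ℕ} (hc : P.IsBounded c)
    (i : Fin k) :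
    ∑ τ ∈ P.transcripts, ∏ i' ∈ Finset.univ.erase i, ∑ x ∈ P.side i' τ, w i' x ≤ 2 ^ c i := by
  have h1 : ∀ τ, ∏ i' ∈ Finset.univ.erase i, ∑ x ∈ P.side i' τ, w i' x =
      ∑ Y : Fin k → α, if ∀ i', i' ≠ i → Y i' ∈ P.side i' τ then ∏ i', w i' (Y i') else 0 := by
    intro τ
    have hpi : (Finset.univ.filter fun Y : Fin k → α => ∀ i', i' ≠ i → Y i' ∈ P.side i' τ) =
        Fintype.piFinset (Function.update (fun i' => P.side i' τ) i Finset.univ) := by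
      ext Y
      simp only [Finset.mem_filter, Finset.mem_univ, true_and, Fintype.mem_piFinset]
      refine forall_congr' fun i' => ?_
      by_cases h : i' = i
      · subst h; simp
      · simp [h]
    rw [← Finset.sum_filter, hpi, ← Finset.prod_univ_sum,
      ← Finset.mul_prod_erase _ _ (Finset.mem_univ i)]
    simp only [Function.update_self, hw1, one_mul]
    refine Finset.prod_congr rfl fun i' hi' => ?_
    rw [Function.update_of_ne (Finset.ne_of_mem_erase hi')]
  rw [Finset.sum_congr rfl fun τ _ => h1 τ, Finset.sum_comm]
  have h2 : ∀ Y : Fin k → α, (∑ τ ∈ P.transcripts,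
      if ∀ i', i' ≠ i → Y i' ∈ P.side i' τ then ∏ i', w i' (Y i') else 0) ≤
      2 ^ c i * ∏ i', w i' (Y i') := by
    intro Y
    rw [← Finset.sum_filter, Finset.sum_const, nsmul_eq_mul]
    refine mul_le_mul_of_nonneg_right ?_ (Finset.prod_nonneg fun i' _ => hw i' _)
    have hsub : (P.transcripts.filter fun τ => ∀ i', i' ≠ i → Y i' ∈ P.side i' τ) ⊆
        Finset.univ.image fun x => P.transcript (Function.update Y i x) := by
      intro τ hτ
      obtain ⟨hτ, hY⟩ := Finset.mem_filter.1 hτ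
      obtain ⟨Z, -, hZ⟩ := Finset.mem_image.1 hτ
      refine Finset.mem_image.2 ⟨Z i, Finset.mem_univ _, P.transcript_eq_of_forall hZ fun i' => ?_⟩
      by_cases h : i' = i
      · subst h; exact ⟨Z, by simp, hZ⟩
      · simpa [h] using mem_side.1 (hY i' h)
    have := (Finset.card_le_card hsub).trans
      (P.card_image_transcript_le Y i Finset.univ (c i) fun x _ => hc _ _)
    exact_mod_cast this
  refine (Finset.sum_le_sum fun Y _ => h2 Y).trans ?_
  have h3 : ∑ Y : Fin k → α, ∏ i', w i' (Y i') = 1 := by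
    rw [← Fintype.piFinset_univ, ← Finset.prod_univ_sum]
    simp [hw1]
  rw [← Finset.mul_sum, h3, mul_one]

/-- The entropy of what player `i` reveals is at most the number of bits he writes. -/
theorem sum_prod_erase_mul_negMulLog_le (P : Protocol k α) {w : Fin k → α → ℝ}
    (hw : ∀ i x, 0 ≤ w i x) (hw1 : ∀ i, ∑ x, w i x = 1) {c : Fin k → ℕ} (hc : P.IsBounded c)
    (i : Fin k) :
    ∑ τ ∈ P.transcripts, (∏ i' ∈ Finset.univ.erase i, ∑ x ∈ P.side i' τ, w i' x) *
      Real.negMulLog (∑ x ∈ P.side i τ, w i x) ≤ c i * Real.log 2 := by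
  set M : ℝ := 2 ^ c i with hM
  have hM0 : 0 < M := by positivity
  have hpt : ∀ m : ℝ, 0 ≤ m → Real.negMulLog m ≤ m * Real.log M + 1 / M - m := by
    intro m hm
    rcases hm.eq_or_lt with rfl | hm
    · simp [hM0.le]
    · have h := Real.log_le_sub_one_of_pos (show 0 < 1 / (m * M) by positivity)
      rw [one_div, Real.log_inv, Real.log_mul hm.ne' hM0.ne'] at h
      have h' := mul_le_mul_of_nonneg_left h hm.le
      have : m * ((m * M)⁻¹ - 1) = 1 / M - m := by field_simp
      rw [Real.negMulLog]
      linarith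
  have hm0 : ∀ i' τ, 0 ≤ ∑ x ∈ P.side i' τ, w i' x := fun i' τ => Finset.sum_nonneg fun x _ => hw _ _
  have hR0 : ∀ τ, 0 ≤ ∏ i' ∈ Finset.univ.erase i, ∑ x ∈ P.side i' τ, w i' x :=
    fun τ => Finset.prod_nonneg fun _ _ => hm0 _ _
  have hstep : ∀ τ ∈ P.transcripts, (∏ i' ∈ Finset.univ.erase i, ∑ x ∈ P.side i' τ, w i' x) *
      Real.negMulLog (∑ x ∈ P.side i τ, w i x) ≤
      (Real.log M - 1) * ∏ i', ∑ x ∈ P.side i' τ, w i' x +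
        1 / M * ∏ i' ∈ Finset.univ.erase i, ∑ x ∈ P.side i' τ, w i' x := by
    intro τ _
    rw [← Finset.mul_prod_erase Finset.univ _ (Finset.mem_univ i)]
    have := mul_le_mul_of_nonneg_left (hpt _ (hm0 i τ)) (hR0 τ)
    refine this.trans (le_of_eq ?_)
    ring
  refine (Finset.sum_le_sum hstep).trans ?_
  rw [Finset.sum_add_distrib, ← Finset.mul_sum, ← Finset.mul_sum, P.sum_transcripts,
    Finset.prod_congr rfl fun i' _ => hw1 i', Finset.prod_const_one, mul_one]
  have h4 := mul_le_mul_of_nonneg_left (P.sum_transcripts_prod_erase_le hw hw1 hc i)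
    (show 0 ≤ 1 / M by positivity)
  have h5 : 1 / M * 2 ^ c i = 1 := by rw [← hM]; field_simp
  have h6 : Real.log M = c i * Real.log 2 := by rw [hM, Real.log_pow]
  linarith

end Protocol

/-! ### Product laws on bit strings -/

section Weights

variable {n k : ℕ}

/-- The weight of `x` under the product of the laws `p j`. -/
def prodWeight (p : Fin n → Bool → ℝ) (x : Fin n → Bool) : ℝ := ∏ j, p j (x j)

/-- The law of a constant bit. -/
def pointLaw (b b' : Bool) : ℝ := if b' = b then 1 else 0

/-- The law of the bit of player `i` in a coordinate that is given to player `a`. -/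
def coordLaw (a i : Fin k) : Bool → ℝ := if a = i then fun _ => 1 / 2 else pointLaw false

theorem pointLaw_nonneg (b b' : Bool) : 0 ≤ pointLaw b b' := by
  unfold pointLaw; split_ifs <;> norm_num

theorem sum_pointLaw (b : Bool) : ∑ b', pointLaw b b' = 1 := by
  simp [pointLaw]

theorem coordLaw_nonneg (a i : Fin k) (b : Bool) : 0 ≤ coordLaw a i b := by
  unfold coordLaw
  split_ifs
  · norm_num
  · exact pointLaw_nonneg _ _

theorem sum_coordLaw (a i : Fin k) : ∑ b, coordLaw a i b = 1 := by
  unfold coordLaw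
  split_ifs
  · norm_num
  · exact sum_pointLaw _

theorem prodWeight_nonneg {p : Fin n → Bool → ℝ} (hp : ∀ j b, 0 ≤ p j b) (x : Fin n → Bool) :
    0 ≤ prodWeight p x := Finset.prod_nonneg fun j _ => hp j _

theorem sum_prodWeight {p : Fin n → Bool → ℝ} (hp : ∀ j, ∑ b, p j b = 1) :
    ∑ x, prodWeight p x = 1 := by
  unfold prodWeight
  rw [← Fintype.prod_sum]
  simp only [hp, Finset.prod_const_one]

theorem prodWeight_eq_mul_erase (p : Fin n → Bool → ℝ) (j : Fin n) (x : Fin n → Bool) :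
    prodWeight p x = p j (x j) * ∏ j' ∈ Finset.univ.erase j, p j' (x j') :=
  (Finset.mul_prod_erase _ _ (Finset.mem_univ j)).symm

theorem prodWeight_update (p : Fin n → Bool → ℝ) (j : Fin n) (r : Bool → ℝ) (x : Fin n → Bool) :
    prodWeight (Function.update p j r) x = r (x j) * ∏ j' ∈ Finset.univ.erase j, p j' (x j') := by
  rw [prodWeight_eq_mul_erase _ j, Function.update_self]
  congr 1
  exact Finset.prod_congr rfl fun j' hj' => by
    rw [Function.update_of_ne (Finset.ne_of_mem_erase hj')]

theorem update_pointLaw_nonneg {p : Fin n → Bool → ℝ} (hp : ∀ j b, 0 ≤ p j b) (j : Fin n)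
    (b : Bool) (j' : Fin n) (b' : Bool) : 0 ≤ Function.update p j (pointLaw b) j' b' := by
  by_cases h : j' = j
  · subst h; simpa using pointLaw_nonneg _ _
  · simpa [h] using hp j' b'

theorem sum_update_pointLaw {p : Fin n → Bool → ℝ} (hp : ∀ j, ∑ b, p j b = 1) (j : Fin n)
    (b : Bool) (j' : Fin n) : ∑ b', Function.update p j (pointLaw b) j' b' = 1 := by
  by_cases h : j' = j
  · subst h; simpa using sum_pointLaw b
  · simpa [h] using hp j'

/-! ### The level-one inequality -/

/-- The sign `±1` of a bit. -/
def bitSign (b : Bool) : ℝ := if b then -1 else 1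

/-- Gibbs' variational inequality for the function `∑ j, l j * bitSign (x j)`, whose exponential
moment is a product of hyperbolic cosines. -/
theorem sum_mul_div_le_of_uniform {p : Fin n → Bool → ℝ} (hp : ∀ j b, 0 ≤ p j b)
    (hp1 : ∀ j, ∑ b, p j b = 1) {S : Finset (Fin n)} (hS : ∀ j ∈ S, p j = fun _ => 1 / 2)
    (A : Finset (Fin n → Bool)) (hA : 0 < ∑ x ∈ A, prodWeight p x) (l : Fin n → ℝ)
    (hl : ∀ j ∉ S, l j = 0) :
    ∑ j, l j * ((∑ x ∈ A, prodWeight p x * bitSign (x j)) / ∑ x ∈ A, prodWeight p x) ≤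
      ∑ j, l j ^ 2 / 2 - Real.log (∑ x ∈ A, prodWeight p x) := by
  set m := ∑ x ∈ A, prodWeight p x with hm
  have hjensen := convexOn_exp.map_sum_le (t := A) (w := fun x => prodWeight p x / m)
    (p := fun x => ∑ j, l j * bitSign (x j))
    (fun x _ => div_nonneg (prodWeight_nonneg hp x) hA.le)
    (by rw [← Finset.sum_div, ← hm, div_self hA.ne']) (fun _ _ => Set.mem_univ _)
  simp only [smul_eq_mul] at hjensen
  have hlhs : ∑ x ∈ A, prodWeight p x / m * ∑ j, l j * bitSign (x j) =
      ∑ j, l j * ((∑ x ∈ A, prodWeight p x * bitSign (x j)) / m) := by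
    simp only [Finset.mul_sum, Finset.sum_div]
    rw [Finset.sum_comm]
    exact Finset.sum_congr rfl fun j _ => Finset.sum_congr rfl fun x _ => by ring
  have hmgf : ∑ x, prodWeight p x * Real.exp (∑ j, l j * bitSign (x j)) ≤
      Real.exp (∑ j, l j ^ 2 / 2) := by
    have h1 : ∀ x : Fin n → Bool, prodWeight p x * Real.exp (∑ j, l j * bitSign (x j)) =
        ∏ j, p j (x j) * Real.exp (l j * bitSign (x j)) := fun x => by
      rw [Real.exp_sum, prodWeight, ← Finset.prod_mul_distrib]
    simp only [h1]
    rw [← Fintype.prod_sum fun j b => p j b * Real.exp (l j * bitSign b), Real.exp_sum]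
    refine Finset.prod_le_prod (fun j _ => Finset.sum_nonneg fun b _ =>
      mul_nonneg (hp j b) (Real.exp_pos _).le) fun j _ => ?_
    by_cases hj : j ∈ S
    · refine le_trans (le_of_eq ?_) (Real.cosh_le_exp_half_sq (l j))
      rw [Real.cosh_eq, hS j hj]
      simp [bitSign]
      ring
    · simp only [hl j hj, zero_mul, Real.exp_zero, mul_one, hp1]
      simp
  have hrhs : ∑ x ∈ A, prodWeight p x / m * Real.exp (∑ j, l j * bitSign (x j)) ≤
      Real.exp (∑ j, l j ^ 2 / 2) / m := by
    have : ∀ x ∈ A, prodWeight p x / m * Real.exp (∑ j, l j * bitSign (x j)) =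
        prodWeight p x * Real.exp (∑ j, l j * bitSign (x j)) / m := fun x _ => by ring
    rw [Finset.sum_congr rfl this, ← Finset.sum_div]
    refine div_le_div_of_nonneg_right (le_trans ?_ hmgf) hA.le
    exact Finset.sum_le_sum_of_subset_of_nonneg (Finset.subset_univ _) fun x _ _ =>
      mul_nonneg (prodWeight_nonneg hp x) (Real.exp_pos _).le
  rw [← hlhs]
  have h := Real.log_le_log (Real.exp_pos _) (hjensen.trans hrhs)
  rwa [Real.log_exp, Real.log_div (Real.exp_pos _).ne' hA.ne', Real.log_exp] at h

/-- The level-one inequality, in Hellinger form: if a set `A` has mass `m`, then the squared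
differences between the roots of its conditional masses given the two values of a uniform coordinate
add up to at most `4 m log (1 / m)`. -/
theorem sum_sqrt_sub_sqrt_sq_le_negMulLog {p : Fin n → Bool → ℝ} (hp : ∀ j b, 0 ≤ p j b)
    (hp1 : ∀ j, ∑ b, p j b = 1) {S : Finset (Fin n)} (hS : ∀ j ∈ S, p j = fun _ => 1 / 2)
    (A : Finset (Fin n → Bool)) :
    ∑ j ∈ S, (√(∑ x ∈ A, prodWeight (Function.update p j (pointLaw false)) x) -
        √(∑ x ∈ A, prodWeight (Function.update p j (pointLaw true)) x)) ^ 2 ≤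
      4 * Real.negMulLog (∑ x ∈ A, prodWeight p x) := by
  set m := ∑ x ∈ A, prodWeight p x with hm
  set q : Fin n → Bool → ℝ := fun j b =>
    ∑ x ∈ A, prodWeight (Function.update p j (pointLaw b)) x with hq
  set d : Fin n → ℝ := fun j => ∑ x ∈ A, prodWeight p x * bitSign (x j) with hd
  have hm0 : 0 ≤ m := Finset.sum_nonneg fun x _ => prodWeight_nonneg hp x
  have hq0 : ∀ j b, 0 ≤ q j b := fun j b => Finset.sum_nonneg fun x _ =>
    prodWeight_nonneg (update_pointLaw_nonneg hp j b) x
  have hadd : ∀ j ∈ S, q j false + q j true = 2 * m := by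
    intro j hj
    simp only [hq, hm]
    rw [← Finset.sum_add_distrib, Finset.mul_sum]
    refine Finset.sum_congr rfl fun x _ => ?_
    rw [prodWeight_update, prodWeight_update, prodWeight_eq_mul_erase p j, hS j hj]
    cases x j <;> simp [pointLaw]
  have hsub : ∀ j ∈ S, q j false - q j true = 2 * d j := by
    intro j hj
    simp only [hq, hd]
    rw [← Finset.sum_sub_distrib, Finset.mul_sum]
    refine Finset.sum_congr rfl fun x _ => ?_
    rw [prodWeight_update, prodWeight_update, prodWeight_eq_mul_erase p j, hS j hj]
    cases x j <;> simp [pointLaw, bitSign]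
  change ∑ j ∈ S, (√(q j false) - √(q j true)) ^ 2 ≤ _
  rcases hm0.eq_or_lt with h0 | hpos
  · rw [← h0, Real.negMulLog_zero, mul_zero]
    refine (Finset.sum_eq_zero fun j hj => ?_).le
    have := hadd j hj
    have h1 : q j false = 0 := by linarith [hq0 j false, hq0 j true]
    have h2 : q j true = 0 := by linarith [hq0 j false, hq0 j true]
    simp [h1, h2]
  · have hterm : ∀ j ∈ S, (√(q j false) - √(q j true)) ^ 2 ≤ 2 * m * (d j / m) ^ 2 := by
      intro j hj
      have ha := Real.sq_sqrt (hq0 j false)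
      have hb := Real.sq_sqrt (hq0 j true)
      have hA := Real.sqrt_nonneg (q j false)
      have hB := Real.sqrt_nonneg (q j true)
      set a := √(q j false)
      set b := √(q j true)
      have h1 : a ^ 2 + b ^ 2 = 2 * m := by rw [ha, hb]; exact hadd j hj
      have h2 : a ^ 2 - b ^ 2 = 2 * d j := by rw [ha, hb]; exact hsub j hj
      have h3 : (a - b) ^ 2 * (2 * m) ≤ (2 * d j) ^ 2 := by
        rw [← h1, ← h2]
        have : (a ^ 2 - b ^ 2) ^ 2 = (a - b) ^ 2 * (a + b) ^ 2 := by ring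
        rw [this]
        exact mul_le_mul_of_nonneg_left (by nlinarith [mul_nonneg hA hB]) (sq_nonneg _)
      have h4 : 2 * m * (d j / m) ^ 2 = (2 * d j) ^ 2 / (2 * m) := by field_simp
      rw [h4, le_div_iff₀ (by positivity)]
      exact h3
    -- The optimal tilt in the variational inequality is the bias itself.
    have hlev := sum_mul_div_le_of_uniform hp hp1 hS A hpos
      (fun j => if j ∈ S then d j / m else 0) (fun j hj => by simp [hj])
    have e1 : ∑ j, (if j ∈ S then d j / m else 0) * (d j / m) = ∑ j ∈ S, (d j / m) ^ 2 := by
      simp only [ite_mul, zero_mul, Finset.sum_ite_mem, Finset.univ_inter, sq]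
    have e2 : ∑ j, (if j ∈ S then d j / m else 0) ^ 2 / 2 = (∑ j ∈ S, (d j / m) ^ 2) / 2 := by
      simp [ite_pow, Finset.sum_div, ite_div]
    change ∑ j, (if j ∈ S then d j / m else 0) * (d j / m) ≤ _ at hlev
    rw [e1, e2] at hlev
    refine (Finset.sum_le_sum hterm).trans ?_
    rw [← Finset.mul_sum, Real.negMulLog]
    have := mul_le_mul_of_nonneg_left (show ∑ j ∈ S, (d j / m) ^ 2 ≤ -2 * Real.log m by linarith)
      (show 0 ≤ 2 * m by positivity)
    linarith

/-! ### Resampling and pushing forward product laws -/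

/-- The expectation over `W ∼ ν^n` of a quantity that ignores `W j` may be computed on the event
`W j = i`. -/
theorem sum_prod_mul_ite_eq {ν : Fin k → ℝ} (hν : ∑ a, ν a = 1) (j : Fin n) (i : Fin k)
    {F : (Fin n → Fin k) → ℝ} (hF : ∀ W a, F (Function.update W j a) = F W) :
    ∑ W : Fin n → Fin k, (∏ j', ν (W j')) * (if W j = i then F W else 0) =
      ν i * ∑ W : Fin n → Fin k, (∏ j', ν (W j')) * F W := by
  have hswap : ∀ (W : Fin n → Fin k) (a : Fin k),
      ν (W j) * ∏ j', ν (Function.update W j a j') = ν a * ∏ j', ν (W j') := by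
    intro W a
    rw [← Finset.mul_prod_erase _ _ (Finset.mem_univ j),
      ← Finset.mul_prod_erase (a := j) _ (fun j' => ν (W j')) (Finset.mem_univ j),
      Finset.prod_congr rfl fun j' hj' => by
        rw [Function.update_of_ne (Finset.ne_of_mem_erase hj')]]
    simp only [Function.update_self]
    ring
  -- Resample the coordinate `j`: the pairs `(W, a)` and `(update W j a, W j)` have the same law.
  have hL : ∑ W : Fin n → Fin k, (∏ j', ν (W j')) * (if W j = i then F W else 0) =
      ∑ x : (Fin n → Fin k) × Fin k,
        ν x.2 * (∏ j', ν (x.1 j')) * (if x.1 j = i then F x.1 else 0) := by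
    rw [Fintype.sum_prod_type]
    refine Finset.sum_congr rfl fun W _ => ?_
    simp only [← Finset.sum_mul, hν, one_mul]
  have hR : ν i * ∑ W : Fin n → Fin k, (∏ j', ν (W j')) * F W =
      ∑ x : (Fin n → Fin k) × Fin k,
        ν x.2 * (∏ j', ν (x.1 j')) * (if x.2 = i then F x.1 else 0) := by
    rw [Fintype.sum_prod_type, Finset.mul_sum]
    refine Finset.sum_congr rfl fun W _ => ?_
    simp
    ring
  rw [hL, hR]
  refine Finset.sum_bij' (fun x _ => (Function.update x.1 j x.2, x.1 j))
    (fun x _ => (Function.update x.1 j x.2, x.1 j)) (by simp) (by simp) (by simp) (by simp) ?_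
  rintro ⟨W, a⟩ -
  simp only [hF, hswap]

theorem prod_coordLaw_ge (a : Fin k) (b : Fin k → Bool) :
    1 / 2 * ∏ i, pointLaw false (b i) ≤ ∏ i, coordLaw a i (b i) := by
  have : (1 / 2 : ℝ) = ∏ i, if a = i then 1 / 2 else 1 := by simp
  rw [this, ← Finset.prod_mul_distrib]
  refine Finset.prod_le_prod (fun i _ => mul_nonneg (by split_ifs <;> norm_num)
    (pointLaw_nonneg _ _)) fun i _ => ?_
  unfold coordLaw
  split_ifs
  · unfold pointLaw; split_ifs <;> norm_num
  · rw [one_mul]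

/-- The column of bits in a coordinate given to player `a`. -/
theorem sum_ite_eq_prod_coordLaw (a : Fin k) (z : Fin k → Bool) :
    ∑ b : Bool, (if (fun i => if a = i then b else false) = z then (1 / 2 : ℝ) else 0) =
      ∏ i, coordLaw a i (z i) := by
  rw [← Finset.mul_prod_erase _ _ (Finset.mem_univ a)]
  have h : ∏ i ∈ Finset.univ.erase a, coordLaw a i (z i) =
      if ∀ i ∈ Finset.univ.erase a, z i = false then 1 else 0 := by
    rw [Finset.prod_congr rfl fun i hi => show coordLaw a i (z i) = if z i = false then 1 else 0 by
      simp [coordLaw, (Finset.ne_of_mem_erase hi).symm, pointLaw], Finset.prod_ite_zero,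
      Finset.prod_const_one]
    congr
  have hfun : ∀ b : Bool, ((fun i => if a = i then b else false) = z) ↔
      (z a = b ∧ ∀ i ∈ Finset.univ.erase a, z i = false) := by
    intro b
    constructor
    · rintro rfl
      refine ⟨by simp, fun i hi => ?_⟩
      simp [(Finset.ne_of_mem_erase hi).symm]
    · rintro ⟨rfl, h⟩
      ext i
      by_cases hi : a = i
      · subst hi; simp
      · simp [hi, h i (by simp [Ne.symm hi])]
  simp only [hfun]
  rw [h]
  by_cases hz : ∀ i ∈ Finset.univ.erase a, z i = false
  · rw [if_pos hz, mul_one]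
    simp only [and_iff_left hz]
    cases z a <;> simp [coordLaw]
  · rw [if_neg hz, mul_zero]
    exact Finset.sum_eq_zero fun b _ => if_neg fun h' => hz h'.2

/-- The image of a uniform bit string under a map that acts coordinatewise, with columns as values,
when the law of each column is a product over the players. -/
theorem sum_uniform_eq_sum_prod (φ : Fin n → Bool → Fin k → Bool)
    (r : Fin k → Fin n → Bool → ℝ)
    (hr : ∀ j z, ∑ b : Bool, (if φ j b = z then (1 / 2 : ℝ) else 0) = ∏ i, r i j (z i))
    (G : (Fin k → Fin n → Bool) → ℝ) :
    ∑ u : Fin n → Bool, (1 / 2) ^ n * G (fun i j => φ j (u j) i) =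
      ∑ X : Fin k → Fin n → Bool, (∏ i, prodWeight (r i) (X i)) * G X := by
  have h : ∀ X : Fin k → Fin n → Bool, ∏ i, prodWeight (r i) (X i) =
      ∑ u : Fin n → Bool, if (fun i j => φ j (u j) i) = X then (1 / 2 : ℝ) ^ n else 0 := by
    intro X
    unfold prodWeight
    rw [Finset.prod_comm, Finset.prod_congr rfl fun j _ => (hr j fun i => X i j).symm,
      Fintype.prod_sum]
    refine Finset.sum_congr rfl fun u _ => ?_
    rw [Finset.prod_ite_zero]
    simp only [Finset.mem_univ, true_implies, Finset.prod_const, Finset.card_univ,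
      Fintype.card_fin]
    congr 1
    rw [eq_iff_iff]
    constructor
    · intro h; ext i j; exact congrFun (h j) i
    · rintro rfl j; rfl
  simp only [h, Finset.sum_mul]
  rw [Finset.sum_comm]
  exact Finset.sum_congr rfl fun u _ => by simp

end Weights

/-! ### Transcript distributions with one coordinate pinned -/

section Amplitude

variable {n k : ℕ}

/-- The law of the input of player `i`, given the owners `W` of the coordinates and given that his
bit in coordinate `j` is `b`. It does not depend on `W j`. -/
def pinnedLaw (W : Fin n → Fin k) (j : Fin n) (i : Fin k) (b : Bool) : Fin n → Bool → ℝ :=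
  Function.update (fun j' => coordLaw (W j') i) j (pointLaw b)

/-- The square root of the probability of the transcript `τ`, given the owners `W` and given that
in coordinate `j` exactly the players in `A` have a `1`. -/
def amplitude (P : Protocol k (Fin n → Bool)) (W : Fin n → Fin k) (j : Fin n) (A : Finset (Fin k))
    (τ : List (Fin k × Bool)) : ℝ :=
  ∏ i, √(∑ x ∈ P.side i τ, prodWeight (pinnedLaw W j i (decide (i ∈ A))) x)

theorem pinnedLaw_nonneg (W : Fin n → Fin k) (j : Fin n) (i : Fin k) (b : Bool) (j' : Fin n)
    (b' : Bool) : 0 ≤ pinnedLaw W j i b j' b' :=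
  update_pointLaw_nonneg (fun _ _ => coordLaw_nonneg _ _ _) j b j' b'

theorem sum_pinnedLaw (W : Fin n → Fin k) (j : Fin n) (i : Fin k) (b : Bool) (j' : Fin n) :
    ∑ b', pinnedLaw W j i b j' b' = 1 :=
  sum_update_pointLaw (fun _ => sum_coordLaw _ _) j b j'

theorem pinnedLaw_update (W : Fin n → Fin k) (j : Fin n) (a i : Fin k) (b : Bool) :
    pinnedLaw (Function.update W j a) j i b = pinnedLaw W j i b := by
  unfold pinnedLaw
  ext j' b'
  by_cases h : j' = j
  · subst h; simp
  · simp [h]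

variable (P : Protocol k (Fin n → Bool))

theorem amplitude_update (W : Fin n → Fin k) (j : Fin n) (a : Fin k) :
    amplitude P (Function.update W j a) j = amplitude P W j := by
  unfold amplitude
  simp only [pinnedLaw_update]

theorem side_weight_nonneg (W : Fin n → Fin k) (j : Fin n) (i : Fin k) (b : Bool)
    (τ : List (Fin k × Bool)) : 0 ≤ ∑ x ∈ P.side i τ, prodWeight (pinnedLaw W j i b) x :=
  Finset.sum_nonneg fun x _ => prodWeight_nonneg (pinnedLaw_nonneg W j i b) x

theorem amplitude_sq (W : Fin n → Fin k) (j : Fin n) (A : Finset (Fin k))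
    (τ : List (Fin k × Bool)) :
    amplitude P W j A τ ^ 2 =
      ∏ i, ∑ x ∈ P.side i τ, prodWeight (pinnedLaw W j i (decide (i ∈ A))) x := by
  unfold amplitude
  rw [← Finset.prod_pow]
  exact Finset.prod_congr rfl fun i _ => Real.sq_sqrt (side_weight_nonneg P W j i _ τ)

theorem sum_amplitude_sq (W : Fin n → Fin k) (j : Fin n) (A : Finset (Fin k)) :
    ∑ τ ∈ P.transcripts, amplitude P W j A τ ^ 2 = 1 := by
  simp only [amplitude_sq]
  rw [P.sum_transcripts fun i => prodWeight (pinnedLaw W j i (decide (i ∈ A)))]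
  exact Finset.prod_eq_one fun i _ => sum_prodWeight (sum_pinnedLaw W j i _)

theorem amplitude_mul (W : Fin n → Fin k) (j : Fin n) {A B : Finset (Fin k)} (h : Disjoint A B)
    (τ : List (Fin k × Bool)) :
    amplitude P W j A τ * amplitude P W j B τ =
      amplitude P W j ∅ τ * amplitude P W j (A ∪ B) τ := by
  unfold amplitude
  rw [← Finset.prod_mul_distrib, ← Finset.prod_mul_distrib]
  refine Finset.prod_congr rfl fun i _ => ?_
  by_cases hA : i ∈ A
  · have hB : i ∉ B := Finset.disjoint_left.1 h hA
    simp [hA, hB, mul_comm]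
  · simp [hA]

/-- The squared Hellinger distances between the transcripts for the bits `0` and `1` of player `i`,
summed over the coordinates that he owns, are bounded by the number of bits he writes. -/
theorem sum_sqDist_amplitude_le {c : Fin k → ℕ} (hc : P.IsBounded c) (W : Fin n → Fin k)
    (i : Fin k) :
    ∑ j with W j = i, sqDist P.transcripts (amplitude P W j) ∅ {i} ≤ 3 * c i := by
  set w : Fin k → (Fin n → Bool) → ℝ := fun i' => prodWeight fun j => coordLaw (W j) i' with hw
  have hw0 : ∀ i' x, 0 ≤ w i' x := fun i' x => prodWeight_nonneg (fun _ _ => coordLaw_nonneg _ _ _) x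
  have hw1 : ∀ i', ∑ x, w i' x = 1 := fun i' => sum_prodWeight fun _ => sum_coordLaw _ _
  have hent := P.sum_prod_erase_mul_negMulLog_le hw0 hw1 hc i
  -- Only the factor of player `i` depends on his bit in a coordinate that he owns.
  have hterm : ∀ j, W j = i → ∀ τ,
      (amplitude P W j ∅ τ - amplitude P W j {i} τ) ^ 2 =
      (∏ i' ∈ Finset.univ.erase i, ∑ x ∈ P.side i' τ, w i' x) *
        (√(∑ x ∈ P.side i τ, prodWeight (pinnedLaw W j i false) x) -
          √(∑ x ∈ P.side i τ, prodWeight (pinnedLaw W j i true) x)) ^ 2 := by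
    intro j hj τ
    have hfac : ∀ A : Finset (Fin k), A ⊆ {i} → amplitude P W j A τ =
        √(∑ x ∈ P.side i τ, prodWeight (pinnedLaw W j i (decide (i ∈ A))) x) *
          ∏ i' ∈ Finset.univ.erase i, √(∑ x ∈ P.side i' τ, w i' x) := by
      intro A hA
      unfold amplitude
      rw [← Finset.mul_prod_erase _ _ (Finset.mem_univ i)]
      congr 1
      refine Finset.prod_congr rfl fun i' hi' => ?_
      have hne := Finset.ne_of_mem_erase hi'
      have hmem : i' ∉ A := fun h => hne (Finset.mem_singleton.1 (hA h))
      have hlaw : pinnedLaw W j i' false = fun j' => coordLaw (W j') i' := by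
        unfold pinnedLaw
        refine Function.update_eq_self_iff.2 ?_
        simp [coordLaw, hj, hne.symm]
      simp only [hmem, decide_false, hlaw, hw]
    rw [hfac ∅ (Finset.empty_subset _), hfac {i} subset_rfl, ← sub_mul, mul_pow,
      ← Finset.prod_pow, mul_comm]
    simp only [Finset.notMem_empty, decide_false, Finset.mem_singleton, decide_true]
    congr 1
    exact Finset.prod_congr rfl fun i' _ =>
      Real.sq_sqrt (Finset.sum_nonneg fun x _ => hw0 i' x)
  have hlevel : ∀ τ, ∑ j with W j = i, (amplitude P W j ∅ τ - amplitude P W j {i} τ) ^ 2 ≤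
      4 * ((∏ i' ∈ Finset.univ.erase i, ∑ x ∈ P.side i' τ, w i' x) *
        Real.negMulLog (∑ x ∈ P.side i τ, w i x)) := by
    intro τ
    rw [Finset.sum_congr rfl fun j hj => hterm j (Finset.mem_filter.1 hj).2 τ, ← Finset.mul_sum]
    have h1 := sum_sqrt_sub_sqrt_sq_le_negMulLog (p := fun j => coordLaw (W j) i)
      (fun _ _ => coordLaw_nonneg _ _ _) (fun _ => sum_coordLaw _ _)
      (S := Finset.univ.filter fun j => W j = i)
      (fun j hj => by simp [coordLaw, (Finset.mem_filter.1 hj).2]) (P.side i τ)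
    refine (mul_le_mul_of_nonneg_left h1 (Finset.prod_nonneg fun i' _ =>
      Finset.sum_nonneg fun x _ => hw0 i' x)).trans (le_of_eq ?_)
    ring
  unfold sqDist
  rw [Finset.sum_comm]
  refine (Finset.sum_le_sum fun τ _ => hlevel τ).trans ?_
  rw [← Finset.mul_sum]
  have hlog : 4 * Real.log 2 ≤ 3 := by linarith [Real.log_two_lt_d9]
  have := mul_le_mul_of_nonneg_right hlog (Nat.cast_nonneg (α := ℝ) (c i))
  linarith

/-- The probability that the output is `b`, given the owners `W` and given that in coordinate `j` exactly
the players in `A` have a `1`. -/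
def pinnedOutputProb (W : Fin n → Fin k) (j : Fin n) (A : Finset (Fin k)) (b : Bool) : ℝ :=
  ∑ X : Fin k → Fin n → Bool,
    (∏ i, prodWeight (pinnedLaw W j i (decide (i ∈ A))) (X i)) * if P.output X = b then 1 else 0

open Classical in
theorem pinnedOutputProb_eq (W : Fin n → Fin k) (j : Fin n) (A : Finset (Fin k)) (b : Bool) :
    pinnedOutputProb P W j A b =
      ∑ τ ∈ P.transcripts with ∃ X, P.transcript X = τ ∧ P.output X = b,
        amplitude P W j A τ ^ 2 := by
  unfold pinnedOutputProb
  rw [← Finset.sum_fiberwise_of_maps_to (t := P.transcripts) (g := P.transcript)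
    fun X _ => Finset.mem_image_of_mem _ (Finset.mem_univ X), Finset.sum_filter]
  refine Finset.sum_congr rfl fun τ hτ => ?_
  rw [amplitude_sq, ← P.sum_filter_transcript _ hτ]
  split_ifs with h
  · obtain ⟨Y, hY, hb⟩ := h
    refine Finset.sum_congr rfl fun X hX => ?_
    have := P.output_eq_of_transcript_eq ((Finset.mem_filter.1 hX).2.trans hY.symm)
    simp [this, hb]
  · refine Finset.sum_eq_zero fun X hX => ?_
    have : P.output X ≠ b := fun hb => h ⟨X, (Finset.mem_filter.1 hX).2, hb⟩
    simp [this]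

theorem pinnedOutputProb_add (W : Fin n → Fin k) (j : Fin n) (A : Finset (Fin k)) :
    pinnedOutputProb P W j A true + pinnedOutputProb P W j A false = 1 := by
  unfold pinnedOutputProb
  rw [← Finset.sum_add_distrib]
  have : ∑ X : Fin k → Fin n → Bool,
      ∏ i, prodWeight (pinnedLaw W j i (decide (i ∈ A))) (X i) = 1 := by
    rw [← Fintype.prod_sum fun i x => prodWeight (pinnedLaw W j i (decide (i ∈ A))) x]
    exact Finset.prod_eq_one fun i _ => sum_prodWeight (sum_pinnedLaw W j i _)
  refine Eq.trans (Finset.sum_congr rfl fun X _ => ?_) this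
  cases P.output X <;> simp

/-- If the transcript distributions for the two extreme columns are close, then the protocol errs
on one of them. -/
theorem half_le_pinnedOutputProb_add_sqDist (W : Fin n → Fin k) (j : Fin n) :
    1 / 2 ≤ pinnedOutputProb P W j ∅ true + pinnedOutputProb P W j Finset.univ false / 2 +
      sqDist P.transcripts (amplitude P W j) ∅ Finset.univ := by
  classical
  have hadd := pinnedOutputProb_add P W j Finset.univ
  have h : pinnedOutputProb P W j Finset.univ true ≤ 2 * (pinnedOutputProb P W j ∅ true +
      sqDist P.transcripts (amplitude P W j) ∅ Finset.univ) := by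
    rw [pinnedOutputProb_eq, pinnedOutputProb_eq]
    set U := P.transcripts.filter fun τ => ∃ X, P.transcript X = τ ∧ P.output X = true
    have h1 : ∑ τ ∈ U, (amplitude P W j ∅ τ - amplitude P W j Finset.univ τ) ^ 2 ≤
        sqDist P.transcripts (amplitude P W j) ∅ Finset.univ :=
      Finset.sum_le_sum_of_subset_of_nonneg (Finset.filter_subset _ _) fun _ _ _ => sq_nonneg _
    have h2 : ∑ τ ∈ U, amplitude P W j Finset.univ τ ^ 2 ≤ ∑ τ ∈ U,
        2 * (amplitude P W j ∅ τ ^ 2 +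
          (amplitude P W j ∅ τ - amplitude P W j Finset.univ τ) ^ 2) :=
      Finset.sum_le_sum fun τ _ => by
        nlinarith [sq_nonneg (2 * amplitude P W j ∅ τ - amplitude P W j Finset.univ τ)]
    rw [← Finset.mul_sum, Finset.sum_add_distrib] at h2
    linarith
  linarith

end Amplitude

/-! ### From the error bound to distances, and from bits to distances -/

section Error

variable {n k : ℕ}

theorem toOuterMeasure_ne_top {β : Type*} (p : PMF β) (s : Set β) : p.toOuterMeasure s ≠ ⊤ := by
  refine ne_top_of_le_ne_top ENNReal.one_ne_top ?_
  rw [PMF.toOuterMeasure_apply, ← p.tsum_coe]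
  exact ENNReal.tsum_le_tsum fun x => Set.indicator_le_self _ _ _

theorem toReal_toOuterMeasure_bind {α β : Type*} [Fintype α] (p : PMF α) (f : α → PMF β)
    (s : Set β) :
    ((p.bind f).toOuterMeasure s).toReal =
      ∑ a, (p a).toReal * ((f a).toOuterMeasure s).toReal := by
  rw [PMF.toOuterMeasure_bind_apply, tsum_fintype, ENNReal.toReal_sum]
  · simp only [ENNReal.toReal_mul]
  · exact fun a _ => ENNReal.mul_ne_top (p.apply_ne_top a) (toOuterMeasure_ne_top _ _)

theorem toReal_toOuterMeasure_pure {β : Type*} (x : β) (s : Set β) [Decidable (x ∈ s)] :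
    ((PMF.pure x).toOuterMeasure s).toReal = if x ∈ s then 1 else 0 := by
  rw [PMF.toOuterMeasure_pure_apply]
  split_ifs <;> simp

/-- The disjoint input with owners `W` and bit string `u`. -/
def assembleInput (W : Fin n → Fin k) (u : Fin n → Bool) : Inputs k n :=
  fun i j => if W j = i then u j else false

theorem toReal_prodDist (ν : PMF (Fin k)) (W : Fin n → Fin k) :
    (prodDist ν n W).toReal = ∏ j, (ν (W j)).toReal := by
  rw [prodDist, PMF.ofFintype_apply, ENNReal.toReal_prod]

theorem toReal_disjDist (ν : PMF (Fin k)) (s : Set (Inputs k n)) [DecidablePred (· ∈ s)] :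
    ((disjDist ν n).toOuterMeasure s).toReal =
      ∑ W : Fin n → Fin k, (∏ j, (ν (W j)).toReal) *
        ∑ u : Fin n → Bool, (1 / 2) ^ n * if assembleInput W u ∈ s then 1 else 0 := by
  have h : disjDist ν n = (prodDist ν n).bind fun W =>
      (PMF.uniformOfFintype (Fin n → Bool)).bind fun u => PMF.pure (assembleInput W u) := rfl
  simp only [h, toReal_toOuterMeasure_bind, toReal_toOuterMeasure_pure, toReal_prodDist,
    PMF.uniformOfFintype_apply]
  simp

theorem toReal_interDist [NeZero n] (ν : PMF (Fin k)) (s : Set (Inputs k n))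
    [DecidablePred (· ∈ s)] :
    ((interDist ν n).toOuterMeasure s).toReal =
      ∑ W : Fin n → Fin k, (∏ j, (ν (W j)).toReal) *
        ∑ u : Fin n → Bool, (1 / 2 : ℝ) ^ n * ∑ j₀ : Fin n, 1 / (n : ℝ) *
          if (fun i j => if j = j₀ then true else assembleInput W u i j) ∈ s then 1 else 0 := by
  have h : interDist ν n = (prodDist ν n).bind fun W =>
      (PMF.uniformOfFintype (Fin n → Bool)).bind fun u =>
        (PMF.uniformOfFintype (Fin n)).bind fun j₀ =>
          PMF.pure fun i j => if j = j₀ then true else assembleInput W u i j := by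
    have h' : disjDist ν n = (prodDist ν n).bind fun W =>
      (PMF.uniformOfFintype (Fin n → Bool)).bind fun u => PMF.pure (assembleInput W u) := rfl
    rw [interDist, h']
    simp only [PMF.bind_bind, PMF.pure_bind]
    rfl
  simp only [h, toReal_toOuterMeasure_bind, toReal_toOuterMeasure_pure, toReal_prodDist,
    PMF.uniformOfFintype_apply]
  simp

/-- The probability of the output `true` on disjoint inputs is at least half of what it is when the
column `j` is set to zero: the bit of its owner vanishes with probability one half. -/
theorem pinnedOutputProb_empty_le (ν : PMF (Fin k)) (P : Protocol k (Fin n → Bool)) (j : Fin n) :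
    ∑ W : Fin n → Fin k, (∏ j, (ν (W j)).toReal) * pinnedOutputProb P W j ∅ true ≤
      2 * ((disjDist ν n).toOuterMeasure {X | P.output X = true}).toReal := by
  classical
  rw [toReal_disjDist, Finset.mul_sum]
  refine Finset.sum_le_sum fun W _ => ?_
  have h1 := sum_uniform_eq_sum_prod (fun j b i => if W j = i then b else false)
    (fun i j => coordLaw (W j) i) (fun j z => sum_ite_eq_prod_coordLaw (W j) z)
    (fun X => if P.output X = true then 1 else 0)
  have h2 : ∑ u : Fin n → Bool, (1 / 2 : ℝ) ^ n *
      (if assembleInput W u ∈ {X | P.output X = true} then 1 else 0) =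
      ∑ X : Fin k → Fin n → Bool, (∏ i, prodWeight (fun j => coordLaw (W j) i) (X i)) *
        if P.output X = true then 1 else 0 := h1
  rw [h2, mul_left_comm]
  refine mul_le_mul_of_nonneg_left ?_ (Finset.prod_nonneg fun _ _ => ENNReal.toReal_nonneg)
  rw [pinnedOutputProb, Finset.mul_sum]
  refine Finset.sum_le_sum fun X _ => ?_
  rw [← mul_assoc]
  refine mul_le_mul_of_nonneg_right ?_ (by split_ifs <;> norm_num)
  simp only [pinnedLaw, prodWeight_update, Finset.notMem_empty, decide_false]
  simp only [prodWeight_eq_mul_erase _ j, Finset.prod_mul_distrib]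
  rw [← mul_assoc]
  refine mul_le_mul_of_nonneg_right ?_ (Finset.prod_nonneg fun i _ =>
    Finset.prod_nonneg fun _ _ => coordLaw_nonneg _ _ _)
  linarith [prod_coordLaw_ge (W j) fun i => X i j]

theorem toReal_interDist_output_false [NeZero n] (ν : PMF (Fin k))
    (P : Protocol k (Fin n → Bool)) :
    ((interDist ν n).toOuterMeasure {X | P.output X = false}).toReal =
      1 / n * ∑ j : Fin n, ∑ W : Fin n → Fin k, (∏ j, (ν (W j)).toReal) *
        pinnedOutputProb P W j Finset.univ false := by
  classical
  rw [toReal_interDist, Finset.sum_comm (s := (Finset.univ : Finset (Fin n))), Finset.mul_sum]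
  refine Finset.sum_congr rfl fun W _ => ?_
  conv_rhs => rw [← Finset.mul_sum, mul_left_comm]
  congr 1
  simp only [Finset.mul_sum]
  rw [Finset.sum_comm]
  refine Finset.sum_congr rfl fun j₀ _ => ?_
  have h1 := sum_uniform_eq_sum_prod
    (fun j b i => if j = j₀ then true else if W j = i then b else false)
    (fun i => pinnedLaw W j₀ i (decide (i ∈ Finset.univ)))
    (fun j z => by
      by_cases hj : j = j₀
      · subst hj
        simp only [if_true, pinnedLaw, Function.update_self, Finset.mem_univ, decide_true,
          pointLaw]
        rw [Finset.prod_ite_zero]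
        by_cases hz : ∀ i, z i = true
        · rw [if_pos fun i _ => hz i, if_pos (funext fun i => (hz i).symm)]
          simp
        · rw [if_neg fun h => hz fun i => (congrFun h i).symm,
            if_neg fun h => hz fun i => h i (Finset.mem_univ i)]
          simp
      · simp only [hj, if_false, pinnedLaw, Function.update_of_ne hj]
        exact sum_ite_eq_prod_coordLaw (W j) z)
    (fun X => if P.output X = false then 1 else 0)
  rw [pinnedOutputProb, ← h1, Finset.mul_sum]
  refine Finset.sum_congr rfl fun u _ => ?_
  rw [mul_left_comm]
  rfl

theorem error_add_error_le [NeZero n] (ν : PMF (Fin k)) (P : Protocol k (Fin n → Bool))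
    (h : SolvesWithError P ν (2 / 100)) :
    ((disjDist ν n).toOuterMeasure {X | P.output X = true}).toReal +
      ((interDist ν n).toOuterMeasure {X | P.output X = false}).toReal ≤ 4 / 100 := by
  have h' := ENNReal.toReal_mono (by finiteness) h
  rw [mixDist, toReal_toOuterMeasure_bind] at h'
  simp only [PMF.toOuterMeasure_map_apply, PMF.uniformOfFintype_apply, Fintype.sum_bool,
    caseDist] at h'
  have e1 : (fun X : Inputs k n => (true, X)) ⁻¹' {p | P.output p.2 ≠ p.1} =
      {X | P.output X = false} := by ext X; simp
  have e2 : (fun X : Inputs k n => (false, X)) ⁻¹' {p | P.output p.2 ≠ p.1} =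
      {X | P.output X = true} := by ext X; simp
  rw [e1, e2] at h'
  have e3 : ((Fintype.card Bool : ℝ≥0∞)⁻¹).toReal = 1 / 2 := by simp
  have e4 : (2 / 100 : ℝ≥0∞).toReal = 2 / 100 := by simp
  simp only [e3, e4, if_true, Bool.false_eq_true, if_false] at h'
  linarith

/-- A protocol with small error separates the two extreme columns in an average coordinate. -/
theorem le_sum_sqDist_amplitude [NeZero n] (ν : PMF (Fin k)) (P : Protocol k (Fin n → Bool))
    (h : SolvesWithError P ν (2 / 100)) (hν : ∑ a, (ν a).toReal = 1) :
    42 / 100 * (n : ℝ) ≤ ∑ j : Fin n, ∑ W : Fin n → Fin k, (∏ j, (ν (W j)).toReal) *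
      sqDist P.transcripts (amplitude P W j) ∅ Finset.univ := by
  have herr := error_add_error_le ν P h
  rw [toReal_interDist_output_false] at herr
  set e₀ := ((disjDist ν n).toOuterMeasure {X | P.output X = true}).toReal
  have hn : (0 : ℝ) < n := by exact_mod_cast Nat.pos_of_ne_zero (NeZero.ne n)
  have h0 : ∑ j : Fin n, ∑ W : Fin n → Fin k, (∏ j, (ν (W j)).toReal) *
      pinnedOutputProb P W j ∅ true ≤ n * (2 * e₀) := by
    refine (Finset.sum_le_sum fun j _ => pinnedOutputProb_empty_le ν P j).trans ?_
    simp [e₀]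
  have h1 : ∑ W : Fin n → Fin k, ∏ j, (ν (W j)).toReal = 1 := by
    rw [← Fintype.prod_sum fun (_ : Fin n) a => (ν a).toReal]
    simp [hν]
  have h2 : ∑ j : Fin n, ∑ W : Fin n → Fin k, (∏ j, (ν (W j)).toReal) * (1 / 2 : ℝ) ≤
      ∑ j : Fin n, ∑ W : Fin n → Fin k, (∏ j, (ν (W j)).toReal) *
        (pinnedOutputProb P W j ∅ true + pinnedOutputProb P W j Finset.univ false / 2 +
          sqDist P.transcripts (amplitude P W j) ∅ Finset.univ) :=
    Finset.sum_le_sum fun j _ => Finset.sum_le_sum fun W _ =>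
      mul_le_mul_of_nonneg_left (half_le_pinnedOutputProb_add_sqDist P W j)
        (Finset.prod_nonneg fun _ _ => ENNReal.toReal_nonneg)
  simp only [← Finset.sum_mul, h1, mul_add, Finset.sum_add_distrib, ← mul_div_assoc,
    ← Finset.sum_div] at h2
  rw [Finset.sum_const, Finset.card_univ, Fintype.card_fin, nsmul_eq_mul] at h2
  set S₁ := ∑ j : Fin n, ∑ W : Fin n → Fin k, (∏ j, (ν (W j)).toReal) *
    pinnedOutputProb P W j Finset.univ false
  have h3 : n * e₀ + S₁ ≤ n * (4 / 100) := by
    have := mul_le_mul_of_nonneg_left herr hn.le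
    have e : (n : ℝ) * (e₀ + 1 / n * S₁) = n * e₀ + S₁ := by field_simp
    linarith
  have h4 : 0 ≤ S₁ := Finset.sum_nonneg fun j _ => Finset.sum_nonneg fun W _ =>
    mul_nonneg (Finset.prod_nonneg fun _ _ => ENNReal.toReal_nonneg)
      (Finset.sum_nonneg fun X _ => mul_nonneg (Finset.prod_nonneg fun i _ =>
        prodWeight_nonneg (pinnedLaw_nonneg W j i _) _) (by split_ifs <;> norm_num))
  linarith

/-- The direct sum bound: player `i` owns a coordinate with probability `ν i`. -/
theorem mul_sum_sqDist_amplitude_le (ν : PMF (Fin k)) (P : Protocol k (Fin n → Bool))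
    {c : Fin k → ℕ} (hc : P.IsBounded c) (hν : ∑ a, (ν a).toReal = 1) (i : Fin k) :
    (ν i).toReal * ∑ j : Fin n, ∑ W : Fin n → Fin k, (∏ j, (ν (W j)).toReal) *
      sqDist P.transcripts (amplitude P W j) ∅ {i} ≤ 3 * c i := by
  rw [Finset.mul_sum, ← Finset.sum_congr rfl fun j _ => sum_prod_mul_ite_eq hν j i
    (F := fun W => sqDist P.transcripts (amplitude P W j) ∅ {i})
    fun W a => by rw [amplitude_update], Finset.sum_comm]
  have h1 : ∑ W : Fin n → Fin k, ∏ j, (ν (W j)).toReal = 1 := by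
    rw [← Fintype.prod_sum fun (_ : Fin n) a => (ν a).toReal]
    simp [hν]
  calc _ ≤ ∑ W : Fin n → Fin k, (∏ j, (ν (W j)).toReal) * (3 * c i) := by
        refine Finset.sum_le_sum fun W _ => ?_
        rw [← Finset.mul_sum, ← Finset.sum_filter]
        exact mul_le_mul_of_nonneg_left (sum_sqDist_amplitude_le P hc W i)
          (Finset.prod_nonneg fun _ _ => ENNReal.toReal_nonneg)
    _ = 3 * c i := by rw [← Finset.sum_mul, h1, one_mul]

/-- The bits of a silent player do not matter, even in coordinates that he never owns. -/
theorem sqDist_amplitude_singleton_eq_zero (P : Protocol k (Fin n → Bool)) {c : Fin k → ℕ}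
    (hc : P.IsBounded c) {i : Fin k} (hi : c i = 0) (W : Fin n → Fin k) (j : Fin n) :
    sqDist P.transcripts (amplitude P W j) ∅ {i} = 0 := by
  have h := sum_sqDist_amplitude_le P hc (Function.update W j i) i
  have h1 : sqDist P.transcripts (amplitude P (Function.update W j i) j) ∅ {i} ≤ 3 * c i :=
    (Finset.single_le_sum (f := fun j' =>
      sqDist P.transcripts (amplitude P (Function.update W j i) j') ∅ {i})
      (fun j' _ => sqDist_nonneg _ _) (by simp)).trans h
  rw [amplitude_update, hi] at h1
  exact le_antisymm (by simpa using h1) (sqDist_nonneg _ _)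

end Error

end UDisj

end

theorem theorem2p1 :
    ∃ C : ℝ≥0, 0 < C ∧
      ∀ (n k : ℕ) [NeZero n] [NeZero k] (ν : PMF (Fin k)) (c : Fin k → ℕ)
        (P : UDisj.Protocol k (Fin n → Bool)),
        P.IsBounded c → UDisj.SolvesWithError P ν (2 / 100) →
          (C : ℝ≥0∞) * (n : ℝ≥0∞) ≤ ∑ i, (c i : ℝ≥0∞) / ν i := by
  open UDisj in
  refine ⟨1 / 30, by norm_num, fun n k _ _ ν c P hc herr => ?_⟩
  have hν : ∑ a, (ν a).toReal = 1 := by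
    rw [← ENNReal.toReal_sum fun a _ => ν.apply_ne_top a,
      ← tsum_fintype (L := .unconditional _), ν.tsum_coe, ENNReal.toReal_one]
  set E : Fin k → ℝ := fun i => ∑ j : Fin n, ∑ W : Fin n → Fin k, (∏ j, (ν (W j)).toReal) *
    sqDist P.transcripts (amplitude P W j) ∅ {i} with hE
  have hw : ∀ W : Fin n → Fin k, 0 ≤ ∏ j, (ν (W j)).toReal := fun W =>
    Finset.prod_nonneg fun _ _ => ENNReal.toReal_nonneg
  have hE0 : ∀ i, 0 ≤ E i := fun i => Finset.sum_nonneg fun j _ => Finset.sum_nonneg fun W _ =>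
    mul_nonneg (hw W) (sqDist_nonneg _ _)
  have hlow : 42 / 100 * (n : ℝ) ≤ 4 * ∑ i, E i := by
    refine (le_sum_sqDist_amplitude ν P herr hν).trans ?_
    calc _ ≤ ∑ j : Fin n, ∑ W : Fin n → Fin k, (∏ j, (ν (W j)).toReal) *
          (4 * ∑ i, sqDist P.transcripts (amplitude P W j) ∅ {i}) :=
          Finset.sum_le_sum fun j _ => Finset.sum_le_sum fun W _ =>
            mul_le_mul_of_nonneg_left (sqDist_empty_univ_le (sum_amplitude_sq P W j)
              fun A B h τ _ => amplitude_mul P W j h τ) (hw W)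
      _ = 4 * ∑ i, E i := by
          simp only [hE, Finset.mul_sum]
          rw [Finset.sum_comm (s := (Finset.univ : Finset (Fin k)))]
          refine Finset.sum_congr rfl fun j _ => ?_
          rw [Finset.sum_comm (s := (Finset.univ : Finset (Fin k)))]
          exact Finset.sum_congr rfl fun W _ => Finset.sum_congr rfl fun i _ => by ring
  have hup : ∀ i, ENNReal.ofReal (E i) ≤ 3 * ((c i : ℝ≥0∞) / ν i) := by
    intro i
    rcases Nat.eq_zero_or_pos (c i) with hi | hi
    · have : E i = 0 := by
        simp [hE, sqDist_amplitude_singleton_eq_zero P hc hi]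
      simp [this]
    · rw [← mul_div_assoc, ENNReal.le_div_iff_mul_le (Or.inr (by positivity))
        (Or.inl (ν.apply_ne_top i))]
      have h := mul_sum_sqDist_amplitude_le ν P hc hν i
      rw [← ENNReal.ofReal_toReal (ν.apply_ne_top i), ← ENNReal.ofReal_mul (hE0 i), mul_comm]
      refine (ENNReal.ofReal_le_ofReal h).trans (le_of_eq ?_)
      rw [ENNReal.ofReal_mul (by norm_num), ENNReal.ofReal_natCast]
      norm_num
  have h12 : ENNReal.ofReal (42 / 100 * n) ≤ 12 * ∑ i, (c i : ℝ≥0∞) / ν i := by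
    refine (ENNReal.ofReal_le_ofReal hlow).trans ?_
    rw [ENNReal.ofReal_mul (by norm_num), ENNReal.ofReal_sum_of_nonneg fun i _ => hE0 i]
    calc _ ≤ ENNReal.ofReal 4 * ∑ i, 3 * ((c i : ℝ≥0∞) / ν i) := by
          gcongr with i; exact hup i
      _ = 12 * ∑ i, (c i : ℝ≥0∞) / ν i := by
          rw [← Finset.mul_sum, ← mul_assoc]
          norm_num
  have hC : (12 : ℝ≥0∞) * (((1 / 30 : ℝ≥0) : ℝ≥0∞) * n) ≤ ENNReal.ofReal (42 / 100 * n) := by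
    have : (12 : ℝ≥0∞) * (((1 / 30 : ℝ≥0) : ℝ≥0∞) * n) = ENNReal.ofReal (12 * (1 / 30 * n)) := by
      rw [ENNReal.ofReal_mul (by norm_num), ENNReal.ofReal_mul (by norm_num),
        ENNReal.ofReal_natCast, ← ENNReal.ofReal_coe_nnreal]
      norm_num
    rw [this]
    refine ENNReal.ofReal_le_ofReal ?_
    have : (0 : ℝ) ≤ n := Nat.cast_nonneg n
    linarith
  exact (ENNReal.mul_le_mul_iff_right (by norm_num) (by norm_num)).1 (hC.trans h12)
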